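/- Let $d\ge 1$, $n=d+3$, let $a_1,\dots,a_n\in\mathbb{Z}^d$, and let $A\in\mathbb{Z}^{(d+1)\times n}$ be the matrix with columns $(1,a_1),\dots,(1,a_n)$. A matrix is called uniform if none of its maximal minors vanishes. A Gale dual matrix of a real matrix $M$ of maximal rank is a matrix whose columns form a basis of $\ker M$ (the real kernel). For $B\in\mathbb{Z}^{n\times 2}$ let $\mathcal{L}_B\subset\mathbb{Z}^n$ be the lattice generated over $\mathbb{Z}$ by the columns of $B$, and let $I_{\mathcal{L}_B}=\langle x^{u^+}-x^{u^-} : u\in\mathcal{L}_B\rangle\subset\mathbb{R}[x_1,\dots,x_n]$ be its lattice ideal, where $u=u^+-u^-$ is the decomposition into positive and negative parts. An ideal is called Cohen–Macaulay if the quotient ring by it is. For a vector $v\in\mathbb{R}^n$, $\operatorname{sign}(v)\in\{-1,0,1\}^n$ is taken coordinatewise, and for $I\subset\{1,\dots,n\}$ the vector $v_I$ consists of the coordinates of $v$ with index in $I$. Suppose that $A$ is uniform and that $B\in\mathbb{Z}^{n\times 2}$ is a Gale dual matrix of $A$ such that $I_{\mathcal{L}_B}$ is not Cohen–Macaulay.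 Let $B'\in\mathbb{Z}^{n\times 2}$ be any Gale dual matrix of $A$ whose columns $B'_1,B'_2$ form a $\mathbb{Z}$-basis of $\mathcal{L}_B$ and whose rows meet all four open quadrants of $\mathbb{R}^2$, and let $b'_{i_1},\dots,b'_{i_4}$ be rows of $B'$ lying in four different open quadrants. Let $C\in\mathbb{R}^{d\times n}$ be uniform with columns $C_1,\dots,C_n$, and suppose that $\mathbf 0\in\mathbb{R}_{>0}C_1+\dots+\mathbb{R}_{>0}C_n$. Let $D\in\mathbb{R}^{n\times 3}$ be a Gale dual matrix of $C$, with rows $P_1,\dots,P_n\in\mathbb{R}^3$. Let $I_C\subset\{1,\dots,n\}$ be the index set of the minimal set of generators $\{P_i : i\in I_C\}$ of the polyhedral cone generated by $P_1,\dots,P_n$, and let $\mathcal{C}_P^\nu=\{y\in\mathbb{R}^3 : \langle P_i,y\rangle>0,\ i=1,\dots,n\}$. Suppose that $P_{i_1},\dots,P_{i_4}$ define normals to facets of the closure of $\mathcal{C}_P^\nu$, that is, each set $\{y\in\overline{\mathcal{C}_P^\nu} : \langle P_{i_j},y\rangle=0\}$ is a facet of $\overline{\mathcal{C}_P^\nu}$.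 Suppose moreover that for $j=1,2$ there is a vector $v\in\ker(C)$ with $\operatorname{sign}(v_{I_C})=\operatorname{sign}((B'_j)_{I_C})$. Then the system $$\sum_{j=1}^{n} c_{ij}\,x^{a_j}=0,\qquad i=1,\dots,d,$$ has at least one solution $x\in\mathbb{R}_{>0}^d$; that is, the number $n_{\mathcal A}(C)$ of its positive solutions is positive. -/

import Mathlib

open Matrix

namespace GaleDuality

/-! ### Configurations, systems and Gale duality -/

/-- The matrix with columns `(1, a_j)` of the point configuration `a_1, …, a_n`. -/
def configMatrix {d n : ℕ} (a : Fin n → Fin d → ℤ) : Matrix (Fin (d + 1)) (Fin n) ℤ :=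
  Matrix.of (Fin.cons (fun _ => 1) (fun l j => a j l))

/-- The positive solutions of the system `∑ j, C i j * x ^ (a j) = 0`, `i = 1, …, d`,
with integer exponent vectors `a j`. -/
def positiveSolutions {d n : ℕ} (a : Fin n → Fin d → ℤ) (C : Matrix (Fin d) (Fin n) ℝ) :
    Set (Fin d → ℝ) :=
  {x | (∀ l, 0 < x l) ∧ ∀ i, ∑ j, C i j * ∏ l, x l ^ (a j l) = 0}

/-- The (possibly infinite) number of positive solutions. -/
noncomputable def numPositiveSolutions {d n : ℕ} (a : Fin n → Fin d → ℤ)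
    (C : Matrix (Fin d) (Fin n) ℝ) : ℕ∞ :=
  (positiveSolutions a C).encard

/-- For an `r × s` matrix with `r ≤ s`: no maximal minor vanishes. -/
def IsUniform {r s : ℕ} {R : Type*} [CommRing R] (M : Matrix (Fin r) (Fin s) R) : Prop :=
  ∀ f : Fin r → Fin s, Function.Injective f → (M.submatrix id f).det ≠ 0

/-- `N` is Gale dual to `M`: the columns of `N` are a basis of the real kernel of `M`. -/
def IsGaleDual {r s t : ℕ} (M : Matrix (Fin r) (Fin s) ℝ) (N : Matrix (Fin s) (Fin t) ℝ) : Prop :=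
  LinearIndependent ℝ N.col ∧
    Submodule.span ℝ (Set.range N.col) = LinearMap.ker M.mulVecLin

/-- An integer matrix viewed as a real matrix. -/
def toReal {r s : ℕ} (M : Matrix (Fin r) (Fin s) ℤ) : Matrix (Fin r) (Fin s) ℝ :=
  M.map (fun z : ℤ => (z : ℝ))

/-! ### Cones -/

/-- The cone of all linear combinations of the given vectors with strictly positive
coefficients. -/
def positiveCone {m n : ℕ} (v : Fin n → Fin m → ℝ) : Set (Fin m → ℝ) :=
  {y | ∃ c : Fin n → ℝ, (∀ i, 0 < c i) ∧ y = ∑ i, c i • v i}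

/-- The open dual cone `{y | ⟨P_i, y⟩ > 0 for all i}` of the rows `P_i` of `D`. -/
def dualCone {m n : ℕ} (D : Matrix (Fin n) (Fin m) ℝ) : Set (Fin m → ℝ) :=
  {y | ∀ i, 0 < D.row i ⬝ᵥ y}

/-- `v` is an (inner) normal vector to a facet of the closed convex cone `K`: the linear
form given by `v` is nonnegative on `K`, and the face of `K` on which it vanishes is nonempty and
has dimension `dim K - 1`. -/
def IsFacetNormal {m : ℕ} (K : Set (Fin m → ℝ)) (v : Fin m → ℝ) : Prop :=
  (∀ y ∈ K, 0 ≤ v ⬝ᵥ y) ∧ {y ∈ K | v ⬝ᵥ y = 0}.Nonempty ∧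
    Module.finrank ℝ (vectorSpan ℝ {y ∈ K | v ⬝ᵥ y = 0}) + 1 = Module.finrank ℝ (vectorSpan ℝ K)

/-- `I` indexes a minimal set of generators, among the rows of `D`, of the polyhedral cone
generated by the rows of `D`. If `D` is Gale dual to a uniform matrix `C` whose columns have `0` in
their positive cone, there is exactly one such `I`, and it depends only on `C`. -/
def IsMinimalGenerators {m n : ℕ} (D : Matrix (Fin n) (Fin m) ℝ) (I : Set (Fin n)) : Prop :=
  Minimal (fun J : Set (Fin n) =>
    PointedCone.hull ℝ (D.row '' J) = PointedCone.hull ℝ (Set.range D.row)) I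

/-! ### Signs -/

/-- The coordinatewise sign of a vector. -/
noncomputable def signVector {ι : Type*} (v : ι → ℝ) : ι → SignType :=
  fun i => SignType.sign (v i)

/-- The four open quadrants of the plane, counterclockwise: the signs of the coordinates are
`(+,+)`, `(-,+)`, `(-,-)`, `(+,-)`. -/
def openQuadrant : Fin 4 → Set (Fin 2 → ℤ) :=
  ![{b | 0 < b 0 ∧ 0 < b 1}, {b | b 0 < 0 ∧ 0 < b 1},
    {b | b 0 < 0 ∧ b 1 < 0}, {b | 0 < b 0 ∧ b 1 < 0}]

/-! ### Lattice ideals and the Cohen–Macaulay property -/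

/-- The lattice spanned over the integers by the columns of `B`. -/
def columnLattice {n k : ℕ} (B : Matrix (Fin n) (Fin k) ℤ) : Submodule ℤ (Fin n → ℤ) :=
  Submodule.span ℤ (Set.range B.col)

/-- The monomial `x ^ (u⁺)`, where `u⁺` is the positive part of `u`. -/
noncomputable def posPartMonomial {n : ℕ} (u : Fin n → ℤ) : MvPolynomial (Fin n) ℝ :=
  ∏ i, MvPolynomial.X i ^ (u i).toNat

/-- The lattice ideal, generated by all `x ^ (u⁺) - x ^ (u⁻)` with `u` in the lattice. -/
noncomputable def latticeIdeal {n : ℕ} (L : Submodule ℤ (Fin n → ℤ)) :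
    Ideal (MvPolynomial (Fin n) ℝ) :=
  Ideal.span {p | ∃ u ∈ L, p = posPartMonomial u - posPartMonomial (-u)}

/-- A Noetherian local ring is Cohen–Macaulay if its maximal ideal contains a regular sequence
whose length is the Krull dimension of the ring. -/
def IsCohenMacaulayLocal (R : Type*) [CommRing R] [IsLocalRing R] : Prop :=
  IsNoetherianRing R ∧ ∃ rs : List R, (∀ r ∈ rs, r ∈ IsLocalRing.maximalIdeal R) ∧
    RingTheory.Sequence.IsRegular R rs ∧ ((rs.length : ℕ∞) : WithBot ℕ∞) = ringKrullDim R

/-- A Noetherian ring is Cohen–Macaulay if its localizations at all maximal ideals are. -/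
def IsCohenMacaulayRing (R : Type*) [CommRing R] : Prop :=
  IsNoetherianRing R ∧ ∀ (m : Ideal R) [m.IsMaximal],
    IsCohenMacaulayLocal (Localization.AtPrime m)

/-- An ideal is called Cohen–Macaulay if the quotient ring by it is. -/
def IsCohenMacaulayIdeal {R : Type*} [CommRing R] (I : Ideal R) : Prop :=
  IsCohenMacaulayRing (R ⧸ I)

end GaleDuality

namespace GaleDuality

/-! ### A zero of a planar map from its signs along a closed circuit -/

/-! Gale duality turns the system into two equations on the open dual cone. Positive kernel vectors
of `C` are exactly the `D *ᵥ y` with `y` in that cone, and such a vector comes from a positive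
solution as soon as its logarithm is orthogonal to both columns of `B'`, that is, when both
functions `monomialDiff D (B'.col j)` vanish at `y` (`positiveSolutions_nonempty_of_log`).

A common zero is found by a winding argument. Where a linear form with positive exponent vanishes
and those with negative exponents are positive, the difference is negative; with signs exchanged it
is positive. The four given facets carry exponents in the four open quadrants, so two cyclically
consecutive facets share the sign of one exponent. The sign condition on `I` supplies a direction
`w` along which a segment between facet points projects to a boundary arc where the corresponding
difference keeps its sign (`exists_boundary_arc`). Pushed slightly inwards, the four arcs form a
closed circuit along which the planar map meets the half-planes below, right, above and left in
turn. It winds once around the origin, which is impossible for a nonvanishing map on a convex set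
(`exists_zero_of_sign_circuit`). Uniformity keeps control of the forms outside `I`
(`pos_of_notMem_generators`). -/

theorem exists_int_two_mul_lt_of_sin_pos {E : Type*} [TopologicalSpace E] {S : Set E}
    (hS : IsPreconnected S) {τ : E → ℝ} (hτ : ContinuousOn τ S)
    (hsin : ∀ x ∈ S, 0 < Real.sin (τ x * Real.pi)) :
    ∃ k : ℤ, ∀ x ∈ S, (2 * k : ℝ) < τ x ∧ τ x < 2 * k + 1 := by
  rcases S.eq_empty_or_nonempty with rfl | ⟨x₀, hx₀⟩
  · exact ⟨0, by simp⟩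
  -- The sine vanishes at integer multiples of π, so `τ` avoids the integers and its floor is
  -- constant on the preconnected set; positivity of the sine then makes that floor even.
  have hne : ∀ x ∈ S, ∀ m : ℤ, τ x ≠ m := fun x hx m h => by
    have := hsin x hx
    rw [h, Real.sin_int_mul_pi] at this
    exact lt_irrefl _ this
  have hfloor : ∀ x ∈ S, ⌊τ x⌋ = ⌊τ x₀⌋ := by
    intro x hx
    by_contra hxx
    rcases lt_or_gt_of_ne hxx with h | h
    · obtain ⟨y, hy, hyx⟩ := hS.intermediate_value hx hx₀ hτ
        ⟨(Int.floor_lt.1 h).le, Int.floor_le (τ x₀)⟩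
      exact hne y hy _ hyx
    · obtain ⟨y, hy, hyx⟩ := hS.intermediate_value hx₀ hx hτ
        ⟨(Int.floor_lt.1 h).le, Int.floor_le (τ x)⟩
      exact hne y hy _ hyx
  have hlt : ∀ x ∈ S, (⌊τ x₀⌋ : ℝ) < τ x ∧ τ x < ⌊τ x₀⌋ + 1 := fun x hx => by
    rw [← hfloor x hx]
    exact ⟨lt_of_le_of_ne (Int.floor_le _) (hne x hx _).symm, Int.lt_floor_add_one _⟩
  rcases Int.even_or_odd' ⌊τ x₀⌋ with ⟨k, hk | hk⟩
  · refine ⟨k, fun x hx => ?_⟩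
    simpa [hk] using hlt x hx
  · exfalso
    have h1 := hlt x₀ hx₀
    have h2 := hsin x₀ hx₀
    rw [hk] at h1
    push_cast at h1
    have h3 : Real.sin (τ x₀ * Real.pi) = - Real.sin ((τ x₀ - (2 * k + 1)) * Real.pi) := by
      have : τ x₀ * Real.pi = (τ x₀ - (2 * k + 1)) * Real.pi + Real.pi + k * (2 * Real.pi) := by
        ring
      rw [this, Real.sin_add_int_mul_two_pi, Real.sin_add_pi]
    have h4 : 0 < Real.sin ((τ x₀ - (2 * k + 1)) * Real.pi) :=
      Real.sin_pos_of_pos_of_lt_pi (mul_pos (by linarith) Real.pi_pos)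
        (by nlinarith [Real.pi_pos])
    linarith

/-- Without a common zero, `f + g * I` has a continuous logarithm on the simply connected set `U`,
hence a single-valued argument. The circuit through the lower, right, upper and left half-planes
would increase that argument by a full turn. -/
theorem exists_zero_of_sign_circuit {E : Type*} [AddCommGroup E] [Module ℝ E]
    [TopologicalSpace E] [IsTopologicalAddGroup E] [ContinuousSMul ℝ E]
    [LocallyPathConnectedSpace E]
    {U : Set E} (hU : Convex ℝ U) (hUo : IsOpen U) {f g : E → ℝ}
    (hf : ContinuousOn f U) (hg : ContinuousOn g U) {S₁ S₂ S₃ S₄ : Set E}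
    (h₁U : S₁ ⊆ U) (h₂U : S₂ ⊆ U) (h₃U : S₃ ⊆ U) (h₄U : S₄ ⊆ U)
    (h₁c : IsPreconnected S₁) (h₂c : IsPreconnected S₂) (h₃c : IsPreconnected S₃)
    (h₄c : IsPreconnected S₄)
    (h₁ : ∀ x ∈ S₁, g x < 0) (h₂ : ∀ x ∈ S₂, 0 < f x) (h₃ : ∀ x ∈ S₃, 0 < g x)
    (h₄ : ∀ x ∈ S₄, f x < 0)
    (h₁₂ : (S₁ ∩ S₂).Nonempty) (h₂₃ : (S₂ ∩ S₃).Nonempty) (h₃₄ : (S₃ ∩ S₄).Nonempty)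
    (h₄₁ : (S₄ ∩ S₁).Nonempty) : ∃ x ∈ U, f x = 0 ∧ g x = 0 := by
  by_contra! hno
  have hUne : U.Nonempty := h₁₂.mono (Set.inter_subset_left.trans h₁U)
  have hUs : IsSimplyConnected U := by
    have := hU.contractibleSpace hUne
    exact SimplyConnectedSpace.ofContractible U
  obtain ⟨L, hLc, hL⟩ := Complex.exists_continuousOn_eqOn_exp_comp
    (U := U) (g := fun x => (f x : ℂ) + (g x : ℂ) * Complex.I)
    hUs hUo
    ((Complex.continuous_ofReal.comp_continuousOn hf).add
      ((Complex.continuous_ofReal.comp_continuousOn hg).mul continuousOn_const))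
    (by
      rintro ⟨x, hx, h⟩
      have hre := congrArg Complex.re h
      have him := congrArg Complex.im h
      simp only [Complex.add_re, Complex.ofReal_re, Complex.mul_re, Complex.I_re,
        Complex.ofReal_im, Complex.I_im, Complex.zero_re, Complex.add_im, Complex.mul_im,
        Complex.zero_im] at hre him
      exact hno x hx (by linarith) (by linarith))
  set τ : E → ℝ := fun x => (L x).im / Real.pi with hτ_def
  have hτc : ContinuousOn τ U := (Complex.continuous_im.comp_continuousOn hLc).div_const _
  have hτ : ∀ x, τ x * Real.pi = (L x).im := fun x => div_mul_cancel₀ _ Real.pi_ne_zero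
  have hfx : ∀ x ∈ U, f x = Real.exp (L x).re * Real.cos (L x).im := fun x hx => by
    have := congrArg Complex.re (hL hx)
    simpa [Complex.exp_re] using this.symm
  have hgx : ∀ x ∈ U, g x = Real.exp (L x).re * Real.sin (L x).im := fun x hx => by
    have := congrArg Complex.im (hL hx)
    simpa [Complex.exp_im] using this.symm
  -- The shifts 1, 1/2, 0, -1/2 rotate the four half-planes to the upper one, so `τ` lies within 1/2
  -- of `2k₁ - 1/2`, `2k₂`, `2k₃ + 1/2`, `2k₄ + 1` respectively.
  obtain ⟨k₁, hk₁⟩ := exists_int_two_mul_lt_of_sin_pos h₁c (τ := fun x => τ x + 1)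
    ((hτc.mono h₁U).add continuousOn_const) (fun x hx => by
      rw [add_mul, hτ, one_mul, Real.sin_add_pi]
      have := h₁ x hx
      rw [hgx x (h₁U hx)] at this
      exact neg_pos.2 (neg_of_mul_neg_right this (Real.exp_pos _).le))
  obtain ⟨k₂, hk₂⟩ := exists_int_two_mul_lt_of_sin_pos h₂c (τ := fun x => τ x + 1 / 2)
    ((hτc.mono h₂U).add continuousOn_const) (fun x hx => by
      rw [add_mul, hτ, one_div_mul_eq_div, Real.sin_add_pi_div_two]
      have := h₂ x hx
      rw [hfx x (h₂U hx)] at this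
      exact pos_of_mul_pos_right this (Real.exp_pos _).le)
  obtain ⟨k₃, hk₃⟩ := exists_int_two_mul_lt_of_sin_pos h₃c (τ := τ)
    (hτc.mono h₃U) (fun x hx => by
      rw [hτ]
      have := h₃ x hx
      rw [hgx x (h₃U hx)] at this
      exact pos_of_mul_pos_right this (Real.exp_pos _).le)
  obtain ⟨k₄, hk₄⟩ := exists_int_two_mul_lt_of_sin_pos h₄c (τ := fun x => τ x - 1 / 2)
    ((hτc.mono h₄U).sub continuousOn_const) (fun x hx => by
      rw [sub_mul, hτ, one_div_mul_eq_div, Real.sin_sub_pi_div_two]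
      have := h₄ x hx
      rw [hfx x (h₄U hx)] at this
      exact neg_pos.2 (neg_of_mul_neg_right this (Real.exp_pos _).le))
  obtain ⟨x, hx₁, hx₂⟩ := h₁₂
  obtain ⟨y, hy₂, hy₃⟩ := h₂₃
  obtain ⟨z, hz₃, hz₄⟩ := h₃₄
  obtain ⟨w, hw₄, hw₁⟩ := h₄₁
  have a₁ := hk₁ x hx₁
  have a₂ := hk₂ x hx₂
  have b₂ := hk₂ y hy₂
  have b₃ := hk₃ y hy₃
  have c₃ := hk₃ z hz₃
  have c₄ := hk₄ z hz₄
  have d₄ := hk₄ w hw₄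
  have d₁ := hk₁ w hw₁
  -- Each of the first three intersections forces equal integers; at the fourth, `τ w < 2k₁`
  -- contradicts `2k₄ + 1/2 < τ w`.
  have e₁₂ : k₁ = k₂ := by
    have l₁ : k₁ < k₂ + 1 := by
      have : (k₁ : ℝ) < k₂ + 1 := by linarith [a₁.1, a₂.2]
      exact_mod_cast this
    have l₂ : k₂ < k₁ + 1 := by
      have : (k₂ : ℝ) < k₁ + 1 := by linarith [a₁.2, a₂.1]
      exact_mod_cast this
    omega
  have e₂₃ : k₂ = k₃ := by
    have l₁ : k₂ < k₃ + 1 := by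
      have : (k₂ : ℝ) < k₃ + 1 := by linarith [b₂.1, b₃.2]
      exact_mod_cast this
    have l₂ : k₃ < k₂ + 1 := by
      have : (k₃ : ℝ) < k₂ + 1 := by linarith [b₂.2, b₃.1]
      exact_mod_cast this
    omega
  have e₃₄ : k₃ = k₄ := by
    have l₁ : k₃ < k₄ + 1 := by
      have : (k₃ : ℝ) < k₄ + 1 := by linarith [c₃.1, c₄.2]
      exact_mod_cast this
    have l₂ : k₄ < k₃ + 1 := by
      have : (k₄ : ℝ) < k₃ + 1 := by linarith [c₃.2, c₄.1]
      exact_mod_cast this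
    omega
  rw [e₁₂, e₂₃, e₃₄] at d₁
  linarith [d₁.2, d₄.1]

/-! ### Uniform Gale duals of codimension three -/

section Uniform

variable {d n : ℕ}

theorem IsGaleDual.mulVec_injective {r s t : ℕ} {M : Matrix (Fin r) (Fin s) ℝ}
    {N : Matrix (Fin s) (Fin t) ℝ} (h : IsGaleDual M N) : Function.Injective N.mulVec :=
  Matrix.mulVec_injective_iff.2 h.1

theorem IsGaleDual.mulVec_eq_zero_iff {r s t : ℕ} {M : Matrix (Fin r) (Fin s) ℝ}
    {N : Matrix (Fin s) (Fin t) ℝ} (h : IsGaleDual M N) (v : Fin s → ℝ) :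
    M *ᵥ v = 0 ↔ ∃ y, N *ᵥ y = v := by
  have : v ∈ LinearMap.ker M.mulVecLin ↔ v ∈ LinearMap.range N.mulVecLin := by
    rw [← h.2, Matrix.range_mulVecLin]
  simpa using this

/-- Three distinct rows of the Gale dual of a uniform matrix of corank three are linearly
independent: only `0` is orthogonal to all three. -/
theorem IsGaleDual.eq_zero_of_three_rows {C : Matrix (Fin d) (Fin (d + 3)) ℝ}
    {D : Matrix (Fin (d + 3)) (Fin 3) ℝ} (hC : IsUniform C) (hD : IsGaleDual C D)
    {i j k : Fin (d + 3)} (hij : i ≠ j) (hik : i ≠ k) (hjk : j ≠ k) {y : Fin 3 → ℝ}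
    (hi : (D *ᵥ y) i = 0) (hj : (D *ᵥ y) j = 0) (hk : (D *ᵥ y) k = 0) : y = 0 := by
  classical
  -- A kernel vector of `C` vanishing at three places is killed by the invertible submatrix on the
  -- remaining `d` columns.
  set s : Finset (Fin (d + 3)) := ({i, j, k} : Finset _)ᶜ with hs
  have hcard : s.card = d := by
    rw [hs, Finset.card_compl, Fintype.card_fin, Finset.card_eq_three.2 ⟨i, j, k, hij, hik, hjk, rfl⟩]
    omega
  set f := s.orderEmbOfFin hcard with hf
  have hrange : Set.range f = s := Finset.range_orderEmbOfFin s hcard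
  set v := D *ᵥ y with hv
  have hv0 : ∀ l ∉ s, v l = 0 := by
    intro l hl
    simp only [hs, Finset.mem_compl, not_not, Finset.mem_insert, Finset.mem_singleton] at hl
    rcases hl with rfl | rfl | rfl <;> assumption
  have hCv : C *ᵥ v = 0 := (hD.mulVec_eq_zero_iff v).2 ⟨y, rfl⟩
  have hsub : C.submatrix id f *ᵥ (v ∘ f) = 0 := by
    ext r
    have h1 : (C *ᵥ v) r = 0 := congrFun hCv r
    rw [Matrix.mulVec, dotProduct] at h1 ⊢
    rw [Pi.zero_apply, ← h1]
    have himg : s = Finset.univ.image f := by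
      apply Finset.coe_injective
      rw [← hrange]; simp
    rw [← Finset.sum_subset (Finset.subset_univ s) (fun l _ hl => by rw [hv0 l hl, mul_zero]),
      himg, Finset.sum_image (fun a _ b _ h => f.injective h)]
    rfl
  have hvf := Matrix.eq_zero_of_mulVec_eq_zero (hC f f.injective) hsub
  have hvz : v = 0 := by
    ext l
    by_cases hl : l ∈ s
    · obtain ⟨m, rfl⟩ : l ∈ Set.range f := by rw [hrange]; exact hl
      exact congrFun hvf m
    · exact hv0 l hl
  exact hD.mulVec_injective (by rw [← hv, hvz, Matrix.mulVec_zero])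

theorem exists_ne_zero_two_rows (D : Matrix (Fin n) (Fin 3) ℝ) (k l : Fin n) :
    ∃ y : Fin 3 → ℝ, y ≠ 0 ∧ (D *ᵥ y) k = 0 ∧ (D *ᵥ y) l = 0 := by
  have h : LinearMap.ker ((D.submatrix ![k, l] id).mulVecLin) ≠ ⊥ :=
    LinearMap.ker_ne_bot_of_finrank_lt (by simp)
  obtain ⟨y, hy, hy0⟩ := Submodule.exists_mem_ne_zero_of_ne_bot h
  have hy' : D.submatrix ![k, l] id *ᵥ y = 0 := hy
  exact ⟨y, hy0, congrFun hy' 0, congrFun hy' 1⟩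

theorem exists_ne_ne_fin (i k : Fin (d + 3)) : ∃ l, l ≠ i ∧ l ≠ k := by
  classical
  obtain ⟨l, hl⟩ : (({i, k} : Finset (Fin (d + 3)))ᶜ).Nonempty := by
    rw [← Finset.card_pos, Finset.card_compl, Fintype.card_fin]
    have := Finset.card_le_two (a := i) (b := k)
    omega
  exact ⟨l, by simpa using hl⟩

/-- A linear form in the cone hull of the rows indexed by `I` is nonnegative wherever those rows
are, and where it vanishes it is spanned by the rows of `I` vanishing there. -/
theorem nonneg_and_mem_span_of_mem_hull {D : Matrix (Fin n) (Fin 3) ℝ} {I : Set (Fin n)}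
    {y : Fin 3 → ℝ} (hy : ∀ k ∈ I, 0 ≤ (D *ᵥ y) k) {v : Fin 3 → ℝ}
    (hv : v ∈ PointedCone.hull ℝ (D.row '' I)) :
    0 ≤ v ⬝ᵥ y ∧ (v ⬝ᵥ y = 0 →
      v ∈ Submodule.span ℝ (D.row '' {k | k ∈ I ∧ (D *ᵥ y) k = 0})) := by
  induction hv using Submodule.span_induction with
  | mem x hx =>
    obtain ⟨k, hk, rfl⟩ := hx
    exact ⟨hy k hk, fun h => Submodule.subset_span ⟨k, ⟨hk, h⟩, rfl⟩⟩
  | zero => exact ⟨by simp, fun _ => zero_mem _⟩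
  | add u v _ _ hu hv =>
    rw [add_dotProduct]
    exact ⟨add_nonneg hu.1 hv.1, fun h => add_mem (hu.2 (by linarith [hu.1, hv.1]))
      (hv.2 (by linarith [hu.1, hv.1]))⟩
  | smul c v _ hv =>
    have hcv : (c • v) = (c : ℝ) • v := rfl
    rw [hcv, smul_dotProduct, smul_eq_mul]
    refine ⟨mul_nonneg c.2 hv.1, fun h => ?_⟩
    rcases mul_eq_zero.1 h with h | h
    · rw [h, zero_smul]; exact zero_mem _
    · exact Submodule.smul_mem _ _ (hv.2 h)

theorem nonneg_of_generators {D : Matrix (Fin n) (Fin 3) ℝ} {I : Set (Fin n)}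
    (hI : IsMinimalGenerators D I) {y : Fin 3 → ℝ} (hy : ∀ k ∈ I, 0 ≤ (D *ᵥ y) k) (i : Fin n) :
    0 ≤ (D *ᵥ y) i :=
  (nonneg_and_mem_span_of_mem_hull hy (by
    rw [hI.prop]; exact PointedCone.subset_hull ⟨i, rfl⟩ : D.row i ∈ _)).1

/-- A row outside of the minimal set of generators is strictly positive on the punctured closed
dual cone. -/
theorem pos_of_notMem_generators {C : Matrix (Fin d) (Fin (d + 3)) ℝ}
    {D : Matrix (Fin (d + 3)) (Fin 3) ℝ} (hC : IsUniform C) (hD : IsGaleDual C D)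
    {I : Set (Fin (d + 3))} (hI : IsMinimalGenerators D I) {i : Fin (d + 3)} (hi : i ∉ I)
    {y : Fin 3 → ℝ} (hy : ∀ k ∈ I, 0 ≤ (D *ᵥ y) k) (hy0 : y ≠ 0) : 0 < (D *ᵥ y) i := by
  refine lt_of_le_of_ne (nonneg_of_generators hI hy i) fun h0 => ?_
  have hspan := (nonneg_and_mem_span_of_mem_hull hy (by
    rw [hI.prop]; exact PointedCone.subset_hull ⟨i, rfl⟩ : D.row i ∈ _)).2 h0.symm
  -- Together with `i`, at most one row of `I` can vanish at `y ≠ 0`. Row `i` would then be a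
  -- multiple of a single row `k`, against the independence of rows `i`, `k`, `l`.
  obtain ⟨k, hki, hk⟩ : ∃ k, k ≠ i ∧ {k | k ∈ I ∧ (D *ᵥ y) k = 0} ⊆ {k} := by
    by_cases h : ∃ k ∈ I, (D *ᵥ y) k = 0
    · obtain ⟨k, hkI, hk⟩ := h
      refine ⟨k, fun h => hi (h ▸ hkI), fun l hl => ?_⟩
      by_contra hlk
      exact hy0 (hD.eq_zero_of_three_rows hC (fun h : i = k => hi (h ▸ hkI))
        (fun h : i = l => hi (h ▸ hl.1)) (fun h : k = l => hlk h.symm) h0.symm hk hl.2)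
    · obtain ⟨k, hk, -⟩ := exists_ne_ne_fin i i
      exact ⟨k, hk, fun l hl => (h ⟨l, hl⟩).elim⟩
  obtain ⟨l, hli, hlk⟩ := exists_ne_ne_fin i k
  obtain ⟨x, hx0, hxk, hxl⟩ := exists_ne_zero_two_rows D k l
  have hspan' := Submodule.span_mono (Set.image_mono hk) hspan
  rw [Set.image_singleton, Submodule.mem_span_singleton] at hspan'
  obtain ⟨c, hc⟩ := hspan'
  have hxi : (D *ᵥ x) i = 0 := by
    change D.row i ⬝ᵥ x = 0
    rw [← hc, smul_dotProduct, show D.row k ⬝ᵥ x = 0 from hxk, smul_zero]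
  exact hx0 (hD.eq_zero_of_three_rows hC hki.symm hli.symm hlk.symm hxi hxk hxl)

theorem isOpen_dualCone {m : ℕ} (D : Matrix (Fin n) (Fin m) ℝ) : IsOpen (dualCone D) := by
  rw [show dualCone D = ⋂ i, {y | 0 < D.row i ⬝ᵥ y} by ext; simp [dualCone]]
  exact isOpen_iInter_of_finite fun i =>
    isOpen_lt continuous_const (continuous_const.dotProduct continuous_id)

theorem convex_dualCone {m : ℕ} (D : Matrix (Fin n) (Fin m) ℝ) : Convex ℝ (dualCone D) := by
  intro x hx y hy a b ha hb hab i
  rw [dotProduct_add, dotProduct_smul, dotProduct_smul, smul_eq_mul, smul_eq_mul]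
  rcases ha.eq_or_lt with rfl | ha
  · rw [zero_add] at hab
    simpa [hab] using hy i
  · exact add_pos_of_pos_of_nonneg (mul_pos ha (hx i)) (mul_nonneg hb (hy i).le)

theorem nonneg_of_mem_closure_dualCone {m : ℕ} {D : Matrix (Fin n) (Fin m) ℝ} {y : Fin m → ℝ}
    (hy : y ∈ closure (dualCone D)) (i : Fin n) : 0 ≤ (D *ᵥ y) i := by
  have hcl : IsClosed {y : Fin m → ℝ | 0 ≤ D.row i ⬝ᵥ y} :=
    isClosed_le continuous_const (continuous_const.dotProduct continuous_id)
  exact closure_minimal (fun x hx => (hx i).le) hcl hy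

theorem IsGaleDual.dualCone_nonempty {C : Matrix (Fin d) (Fin n) ℝ}
    {m : ℕ} {D : Matrix (Fin n) (Fin m) ℝ} (hD : IsGaleDual C D)
    (h0 : (0 : Fin d → ℝ) ∈ positiveCone C.col) : (dualCone D).Nonempty := by
  obtain ⟨c, hc, h⟩ := h0
  have hCc : C *ᵥ c = 0 := by
    rw [h]
    ext r
    simp [Matrix.mulVec, dotProduct, mul_comm]
  obtain ⟨y, hy⟩ := (hD.mulVec_eq_zero_iff c).1 hCc
  exact ⟨y, fun i => by
    have := congrFun hy i
    change (D *ᵥ y) i = c i at this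
    change 0 < (D *ᵥ y) i
    rw [this]
    exact hc i⟩

/-- The facet cut out by a row contains a point on which all other rows are positive. -/
theorem exists_facet_point {C : Matrix (Fin d) (Fin (d + 3)) ℝ}
    {D : Matrix (Fin (d + 3)) (Fin 3) ℝ} (hC : IsUniform C) (hD : IsGaleDual C D)
    (hne : (dualCone D).Nonempty) {j : Fin (d + 3)}
    (hj : IsFacetNormal (closure (dualCone D)) (D.row j)) :
    ∃ z : Fin 3 → ℝ, (D *ᵥ z) j = 0 ∧ ∀ i, i ≠ j → 0 < (D *ᵥ z) i := by
  classical
  set F := {y ∈ closure (dualCone D) | D.row j ⬝ᵥ y = 0} with hF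
  have htop : vectorSpan ℝ (closure (dualCone D)) = ⊤ := by
    have h := (isOpen_dualCone D).affineSpan_eq_top hne
    have h' : affineSpan ℝ (closure (dualCone D)) = ⊤ :=
      top_le_iff.1 (h ▸ affineSpan_mono ℝ subset_closure)
    rw [← direction_affineSpan, h', AffineSubspace.direction_top]
  have hrank : Module.finrank ℝ (vectorSpan ℝ F) = 2 := by
    have : Module.finrank ℝ (vectorSpan ℝ F) + 1 =
        Module.finrank ℝ (vectorSpan ℝ (closure (dualCone D))) := hj.2.2
    rw [htop, finrank_top, Module.finrank_fin_fun] at this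
    omega
  -- If row `i` vanished on the whole facet, rows `i` and `j` would both vanish on its
  -- two-dimensional direction space, where a third row `k` would be injective. Summing the
  -- witnesses over all `i` gives the point sought.
  have hpt : ∀ i, i ≠ j → ∃ y ∈ F, 0 < (D *ᵥ y) i := by
    intro i hij
    by_contra! hcon
    obtain ⟨k, hkj, hki⟩ := exists_ne_ne_fin j i
    have hzero : ∀ y ∈ F, (D *ᵥ y) i = 0 := fun y hy =>
      le_antisymm (hcon y hy) (nonneg_of_mem_closure_dualCone hy.1 i)
    have hle : ∀ l, (∀ y ∈ F, (D *ᵥ y) l = 0) →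
        vectorSpan ℝ F ≤ LinearMap.ker ((LinearMap.proj l).comp D.mulVecLin) := by
      intro l hl
      rw [vectorSpan_def, Submodule.span_le]
      rintro _ ⟨x, hx, y, hy, rfl⟩
      simp [Matrix.mulVec_sub, hl x hx, hl y hy]
    have hinj : Function.Injective
        (((LinearMap.proj k).comp D.mulVecLin).comp (vectorSpan ℝ F).subtype) := by
      rw [← LinearMap.ker_eq_bot, LinearMap.ker_eq_bot']
      intro y hy
      have h1 : (D *ᵥ y.1) i = 0 := hle i hzero y.2
      have h2 : (D *ᵥ y.1) j = 0 := hle j (fun y hy => hy.2) y.2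
      exact Subtype.ext (hD.eq_zero_of_three_rows hC hij hki.symm hkj.symm h1 h2 hy)
    have := LinearMap.finrank_le_finrank_of_injective hinj
    rw [hrank, Module.finrank_self] at this
    omega
  choose! y hyF hypos using hpt
  refine ⟨∑ i ∈ Finset.univ.erase j, y i, ?_, fun i hi => ?_⟩
  · rw [Matrix.mulVec_sum, Finset.sum_apply]
    exact Finset.sum_eq_zero fun i hi => (hyF i (Finset.ne_of_mem_erase hi)).2
  · rw [Matrix.mulVec_sum, Finset.sum_apply]
    exact Finset.sum_pos' (fun l hl =>
      nonneg_of_mem_closure_dualCone (hyF l (Finset.ne_of_mem_erase hl)).1 i)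
      ⟨i, by simp [hi], hypos i hi⟩

end Uniform

/-! ### Signed monomial differences on the dual cone -/

/-- The difference of the two monomials in the linear forms `⟨P_i, y⟩` whose exponents are the
positive and the negative part of `β`. -/
noncomputable def monomialDiff {n : ℕ} (D : Matrix (Fin n) (Fin 3) ℝ) (β : Fin n → ℤ)
    (y : Fin 3 → ℝ) : ℝ :=
  ∏ i, (D *ᵥ y) i ^ (β i).toNat - ∏ i, (D *ᵥ y) i ^ (-β i).toNat

section MonomialDiff

variable {n : ℕ} (D : Matrix (Fin n) (Fin 3) ℝ) (β : Fin n → ℤ)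

theorem continuous_mulVec_apply (i : Fin n) : Continuous fun y => (D *ᵥ y) i :=
  (continuous_apply i).comp (continuous_const.matrix_mulVec continuous_id)

theorem continuous_monomialDiff : Continuous (monomialDiff D β) :=
  (continuous_finsetProd _ fun i _ => (continuous_mulVec_apply D i).pow _).sub
    (continuous_finsetProd _ fun i _ => (continuous_mulVec_apply D i).pow _)

theorem monomialDiff_neg (y : Fin 3 → ℝ) : monomialDiff D (-β) y = -monomialDiff D β y := by
  simp [monomialDiff]

variable {D β}

/-- The vanishing form kills the first product, while only forms with negative `β` have a nonzero
exponent in the second. -/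
theorem monomialDiff_neg_of_vanishing {y : Fin 3 → ℝ}
    (h0 : ∃ i, 0 < β i ∧ (D *ᵥ y) i = 0) (hpos : ∀ i, β i < 0 → 0 < (D *ᵥ y) i) :
    monomialDiff D β y < 0 := by
  obtain ⟨i, hi, hi0⟩ := h0
  have h1 : ∏ i, (D *ᵥ y) i ^ (β i).toNat = 0 :=
    Finset.prod_eq_zero (Finset.mem_univ i) (by rw [hi0, zero_pow (by omega)])
  have h2 : 0 < ∏ i, (D *ᵥ y) i ^ (-β i).toNat := by
    refine Finset.prod_pos fun k _ => ?_
    rcases lt_or_ge (β k) 0 with hk | hk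
    · exact pow_pos (hpos k hk) _
    · rw [Int.toNat_of_nonpos (by omega), pow_zero]
      exact one_pos
  rw [monomialDiff, h1]
  linarith

theorem sum_mul_log_eq_zero {y : Fin 3 → ℝ} (hy : ∀ i, 0 < (D *ᵥ y) i)
    (h : monomialDiff D β y = 0) : ∑ i, (β i : ℝ) * Real.log ((D *ᵥ y) i) = 0 := by
  have h' := congrArg Real.log (sub_eq_zero.1 h)
  rw [Real.log_prod fun i _ => (pow_pos (hy i) _).ne',
    Real.log_prod fun i _ => (pow_pos (hy i) _).ne'] at h'
  simp only [Real.log_pow] at h'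
  rw [← sub_eq_zero.2 h', ← Finset.sum_sub_distrib]
  refine Finset.sum_congr rfl fun i _ => ?_
  have hβ : (β i : ℝ) = ((β i).toNat : ℝ) - ((-β i).toNat : ℝ) := by
    exact_mod_cast (Int.toNat_sub_toNat_neg (β i)).symm
  rw [hβ, sub_mul]

end MonomialDiff

/-! ### Boundary arcs of the dual cone and the common zero -/

section BoundaryArc

variable {d : ℕ} {C : Matrix (Fin d) (Fin (d + 3)) ℝ} {D : Matrix (Fin (d + 3)) (Fin 3) ℝ}

/-- Two facets on which `β` is positive are joined by an arc in the boundary of the dual cone that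
stays in the facets on which `β` is positive: project the segment between `z` and `z'` along a
vector `w` having the signs of `β`. -/
theorem exists_boundary_arc (hC : IsUniform C) (hD : IsGaleDual C D) {I : Set (Fin (d + 3))}
    (hI : IsMinimalGenerators D I) {β : Fin (d + 3) → ℤ} {w : Fin 3 → ℝ}
    (hwpos : ∀ k ∈ I, 0 < β k → 0 < (D *ᵥ w) k) (hwneg : ∀ k ∈ I, β k < 0 → (D *ᵥ w) k < 0)
    (hwzero : ∀ k ∈ I, β k = 0 → (D *ᵥ w) k = 0)
    {r r' s : Fin (d + 3)} (hr : r ∈ I) (hr' : r' ∈ I) (hs : s ∈ I) (hβr : 0 < β r)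
    (hβr' : 0 < β r') (hβs : β s < 0) {z z' : Fin 3 → ℝ} (hzr : (D *ᵥ z) r = 0)
    (hz : ∀ i, i ≠ r → 0 < (D *ᵥ z) i) (hzr' : (D *ᵥ z') r' = 0)
    (hz' : ∀ i, i ≠ r' → 0 < (D *ᵥ z') i) :
    ∃ K : Set (Fin 3 → ℝ), IsCompact K ∧ IsPreconnected K ∧ z ∈ K ∧ z' ∈ K ∧
      ∀ y ∈ K, (∀ i, 0 ≤ (D *ᵥ y) i) ∧ (∃ i, 0 < β i ∧ (D *ᵥ y) i = 0) ∧
        ∀ i, β i < 0 → 0 < (D *ᵥ y) i := by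
  classical
  set P : Finset (Fin (d + 3)) := {k | k ∈ I ∧ 0 < β k} with hP
  have hPr : r ∈ P := by simp [hP, hr, hβr]
  have hPr' : r' ∈ P := by simp [hP, hr', hβr']
  have hPne : P.Nonempty := ⟨r, hPr⟩
  have hPw : ∀ k ∈ P, 0 < (D *ᵥ w) k := fun k hk => by
    simp only [hP, Finset.mem_filter_univ] at hk
    exact hwpos k hk.1 hk.2
  -- `T y` is the largest `t` for which `y - t • w` stays nonnegative on the rows of `P`; there one
  -- of them vanishes. It is `0` at `z` and `z'`, so the projection fixes both endpoints.
  set T : (Fin 3 → ℝ) → ℝ := fun y => P.inf' hPne fun k => (D *ᵥ y) k / (D *ᵥ w) k with hT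
  have hTc : Continuous T := Continuous.finset_inf'_apply hPne fun k _ =>
    (continuous_mulVec_apply D k).div_const _
  have hT0 : ∀ y, (∀ i, 0 ≤ (D *ᵥ y) i) → 0 ≤ T y := fun y hy =>
    Finset.le_inf' _ _ fun k hk => div_nonneg (hy k) (hPw k hk).le
  have hTz : ∀ y k, k ∈ P → (∀ i, 0 ≤ (D *ᵥ y) i) → (D *ᵥ y) k = 0 → T y = 0 :=
    fun y k hk hy hyk => le_antisymm
      ((Finset.inf'_le _ hk).trans (by rw [hyk, zero_div])) (hT0 y hy)
  have hexp : ∀ y k, (D *ᵥ (y - T y • w)) k = (D *ᵥ y) k - T y * (D *ᵥ w) k := fun y k => by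
    rw [Matrix.mulVec_sub, Matrix.mulVec_smul]
    rfl
  have hz0 : ∀ i, 0 ≤ (D *ᵥ z) i := fun i => by
    by_cases h : i = r
    · rw [h, hzr]
    · exact (hz i h).le
  have hz'0 : ∀ i, 0 ≤ (D *ᵥ z') i := fun i => by
    by_cases h : i = r'
    · rw [h, hzr']
    · exact (hz' i h).le
  have hseg : ∀ y ∈ segment ℝ z z', (∀ i, 0 ≤ (D *ᵥ y) i) ∧
      ∀ i, i ≠ r → i ≠ r' → 0 < (D *ᵥ y) i := by
    rintro y ⟨a, b, ha, hb, hab, rfl⟩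
    have hlin : ∀ i, (D *ᵥ (a • z + b • z')) i = a * (D *ᵥ z) i + b * (D *ᵥ z') i := fun i => by
      rw [Matrix.mulVec_add, Matrix.mulVec_smul, Matrix.mulVec_smul]
      rfl
    refine ⟨fun i => ?_, fun i hi hi' => ?_⟩
    · rw [hlin]
      exact add_nonneg (mul_nonneg ha (hz0 i)) (mul_nonneg hb (hz'0 i))
    · rw [hlin]
      rcases ha.eq_or_lt with rfl | ha
      · rw [zero_add] at hab
        simpa [hab] using hz' i hi'
      · exact add_pos_of_pos_of_nonneg (mul_pos ha (hz i hi)) (mul_nonneg hb (hz'0 i))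
  have hπc : Continuous fun y => y - T y • w := continuous_id.sub (hTc.smul continuous_const)
  have hcomp : IsCompact (segment ℝ z z') := by
    rw [segment_eq_image_lineMap]
    exact isCompact_Icc.image AffineMap.lineMap_continuous
  refine ⟨(fun y => y - T y • w) '' segment ℝ z z', hcomp.image hπc,
    (convex_segment z z').isPreconnected.image _ hπc.continuousOn,
    ⟨z, left_mem_segment ℝ z z', by simp [hTz z r hPr hz0 hzr]⟩,
    ⟨z', right_mem_segment ℝ z z', by simp [hTz z' r' hPr' hz'0 hzr']⟩, ?_⟩
  rintro _ ⟨y, hy, rfl⟩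
  obtain ⟨hy0, hypos⟩ := hseg y hy
  -- Such a `k` differs from `r` and `r'`, so its form is positive on the segment, and moving along
  -- `-w` can only increase it.
  have hnegI : ∀ k ∈ I, β k < 0 → 0 < (D *ᵥ (y - T y • w)) k := fun k hk hβ => by
    rw [hexp]
    have h1 := hypos k (fun h => by rw [h] at hβ; omega) (fun h => by rw [h] at hβ; omega)
    have h2 := mul_nonneg (hT0 y hy0) (neg_nonneg.2 (hwneg k hk hβ).le)
    linarith
  have hnonneg : ∀ k ∈ I, 0 ≤ (D *ᵥ (y - T y • w)) k := fun k hk => by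
    rcases lt_trichotomy (β k) 0 with hβ | hβ | hβ
    · exact (hnegI k hk hβ).le
    · rw [hexp, hwzero k hk hβ, mul_zero, sub_zero]
      exact hy0 k
    · rw [hexp, sub_nonneg, ← le_div_iff₀ (hwpos k hk hβ)]
      exact Finset.inf'_le _ (by simp [hP, hk, hβ])
  -- The row `s` keeps the arc away from the apex; this gives positivity of the rows outside `I`, on
  -- which `w` is unconstrained.
  have hne : y - T y • w ≠ 0 := fun h => by
    have := hnegI s hs hβs
    rw [h, Matrix.mulVec_zero] at this
    exact lt_irrefl _ this
  refine ⟨nonneg_of_generators hI hnonneg, ?_, fun i hi => ?_⟩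
  · obtain ⟨k, hk, hTk⟩ := Finset.exists_mem_eq_inf' hPne fun k => (D *ᵥ y) k / (D *ᵥ w) k
    have hTk' : T y = (D *ᵥ y) k / (D *ᵥ w) k := hTk
    refine ⟨k, by simp only [hP, Finset.mem_filter_univ] at hk; exact hk.2, ?_⟩
    rw [hexp, hTk', div_mul_cancel₀ _ (hPw k hk).ne', sub_self]
  · by_cases hiI : i ∈ I
    · exact hnegI i hiI hi
    · exact pos_of_notMem_generators hC hD hI hiI hnonneg hne

/-- Compactness of the arc makes its strict sign stable under all small translations along `e`. A
common translation preserves the endpoints shared by different arcs. -/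
theorem exists_arc_eventually_monomialDiff_neg (hC : IsUniform C) (hD : IsGaleDual C D)
    {I : Set (Fin (d + 3))} (hI : IsMinimalGenerators D I) {β : Fin (d + 3) → ℤ} {w : Fin 3 → ℝ}
    (hwpos : ∀ k ∈ I, 0 < β k → 0 < (D *ᵥ w) k) (hwneg : ∀ k ∈ I, β k < 0 → (D *ᵥ w) k < 0)
    (hwzero : ∀ k ∈ I, β k = 0 → (D *ᵥ w) k = 0)
    {r r' s : Fin (d + 3)} (hr : r ∈ I) (hr' : r' ∈ I) (hs : s ∈ I) (hβr : 0 < β r)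
    (hβr' : 0 < β r') (hβs : β s < 0) {z z' : Fin 3 → ℝ} (hzr : (D *ᵥ z) r = 0)
    (hz : ∀ i, i ≠ r → 0 < (D *ᵥ z) i) (hzr' : (D *ᵥ z') r' = 0)
    (hz' : ∀ i, i ≠ r' → 0 < (D *ᵥ z') i) (e : Fin 3 → ℝ) :
    ∃ K : Set (Fin 3 → ℝ), IsPreconnected K ∧ z ∈ K ∧ z' ∈ K ∧
      (∀ y ∈ K, ∀ i, 0 ≤ (D *ᵥ y) i) ∧
      ∀ᶠ ε : ℝ in nhds 0, ∀ y ∈ K, monomialDiff D β (y + ε • e) < 0 := by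
  obtain ⟨K, hKc, hKp, hzK, hz'K, hK⟩ := exists_boundary_arc hC hD hI hwpos hwneg hwzero hr hr' hs
    hβr hβr' hβs hzr hz hzr' hz'
  refine ⟨K, hKp, hzK, hz'K, fun y hy => (hK y hy).1,
    hKc.eventually_forall_of_forall_eventually fun y hy => ?_⟩
  have hcont : Continuous fun p : ℝ × (Fin 3 → ℝ) => monomialDiff D β (p.2 + p.1 • e) :=
    (continuous_monomialDiff D β).comp
      (continuous_snd.add (continuous_fst.smul continuous_const))
  refine hcont.continuousAt.eventually_lt continuousAt_const ?_
  simpa using monomialDiff_neg_of_vanishing (hK y hy).2.1 (hK y hy).2.2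

/-- A row that cuts out a facet belongs to the minimal set of generators. -/
theorem mem_generators_of_facet_point (hC : IsUniform C) (hD : IsGaleDual C D)
    {I : Set (Fin (d + 3))} (hI : IsMinimalGenerators D I) {r : Fin (d + 3)} {z : Fin 3 → ℝ}
    (hzr : (D *ᵥ z) r = 0) (hz : ∀ i, i ≠ r → 0 < (D *ᵥ z) i) : r ∈ I := by
  by_contra hrI
  have hz0 : z ≠ 0 := by
    rintro rfl
    obtain ⟨l, hl, -⟩ := exists_ne_ne_fin r r
    simpa using hz l hl
  exact (pos_of_notMem_generators hC hD hI hrI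
    (fun k hk => (hz k fun h => hrI (h ▸ hk)).le) hz0).ne' hzr

/-- If four facets have exponent vectors in the four open quadrants, then the two monomial
differences have a common zero in the open dual cone. -/
theorem exists_mem_dualCone_monomialDiff_eq_zero (hC : IsUniform C) (hD : IsGaleDual C D)
    (hne : (dualCone D).Nonempty) {I : Set (Fin (d + 3))} (hI : IsMinimalGenerators D I)
    (β : Fin 2 → Fin (d + 3) → ℤ) {w : Fin 2 → Fin 3 → ℝ}
    (hw : ∀ j, ∀ k ∈ I, SignType.sign ((D *ᵥ w j) k) = SignType.sign (β j k))
    {r : Fin 4 → Fin (d + 3)} (hr : ∀ k, (fun j => β j (r k)) ∈ openQuadrant k)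
    (hfacet : ∀ k, IsFacetNormal (closure (dualCone D)) (D.row (r k))) :
    ∃ y ∈ dualCone D, ∀ j, monomialDiff D (β j) y = 0 := by
  choose z hzr hz using fun k => exists_facet_point hC hD hne (hfacet k)
  have hrI : ∀ k, r k ∈ I := fun k => mem_generators_of_facet_point hC hD hI (hzr k) (hz k)
  obtain ⟨e, he⟩ := hne
  have hpos : ∀ j, ∀ k ∈ I, 0 < β j k → 0 < (D *ᵥ w j) k := fun j k hk h => by
    rw [← sign_eq_one_iff, hw j k hk, sign_eq_one_iff]; exact h
  have hneg : ∀ j, ∀ k ∈ I, β j k < 0 → (D *ᵥ w j) k < 0 := fun j k hk h => by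
    rw [← sign_eq_neg_one_iff, hw j k hk, sign_eq_neg_one_iff]; exact h
  have hzero : ∀ j, ∀ k ∈ I, β j k = 0 → (D *ᵥ w j) k = 0 := fun j k hk h => by
    rw [← sign_eq_zero_iff, hw j k hk, sign_eq_zero_iff]; exact h
  have hneg_apply : ∀ j k, (D *ᵥ (-w j)) k = -(D *ᵥ w j) k := fun j k => by
    rw [Matrix.mulVec_neg]; rfl
  have q₀ : 0 < β 0 (r 0) ∧ 0 < β 1 (r 0) := hr 0
  have q₁ : β 0 (r 1) < 0 ∧ 0 < β 1 (r 1) := hr 1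
  have q₂ : β 0 (r 2) < 0 ∧ β 1 (r 2) < 0 := hr 2
  have q₃ : 0 < β 0 (r 3) ∧ β 1 (r 3) < 0 := hr 3
  have arc : ∀ j, ∀ a b c : Fin 4, 0 < β j (r a) → 0 < β j (r b) → β j (r c) < 0 →
      ∃ K : Set (Fin 3 → ℝ), IsPreconnected K ∧ z a ∈ K ∧ z b ∈ K ∧
        (∀ y ∈ K, ∀ i, 0 ≤ (D *ᵥ y) i) ∧
        ∀ᶠ ε : ℝ in nhds 0, ∀ y ∈ K, monomialDiff D (β j) (y + ε • e) < 0 :=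
    fun j a b c ha hb hc => exists_arc_eventually_monomialDiff_neg hC hD hI (hpos j) (hneg j)
      (hzero j) (hrI a) (hrI b) (hrI c) ha hb hc (hzr a) (hz a) (hzr b) (hz b) e
  have arc' : ∀ j, ∀ a b c : Fin 4, β j (r a) < 0 → β j (r b) < 0 → 0 < β j (r c) →
      ∃ K : Set (Fin 3 → ℝ), IsPreconnected K ∧ z a ∈ K ∧ z b ∈ K ∧
        (∀ y ∈ K, ∀ i, 0 ≤ (D *ᵥ y) i) ∧
        ∀ᶠ ε : ℝ in nhds 0, ∀ y ∈ K, 0 < monomialDiff D (β j) (y + ε • e) := by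
    intro j a b c ha hb hc
    obtain ⟨K, h₁, h₂, h₃, h₄, h₅⟩ := exists_arc_eventually_monomialDiff_neg hC hD hI
      (β := -β j) (w := -w j)
      (fun k hk h => by
        rw [hneg_apply, neg_pos]; exact hneg j k hk (neg_pos.1 h))
      (fun k hk h => by
        rw [hneg_apply, neg_lt_zero]; exact hpos j k hk (neg_lt_zero.1 h))
      (fun k hk h => by
        rw [hneg_apply, neg_eq_zero]; exact hzero j k hk (neg_eq_zero.1 h))
      (hrI a) (hrI b) (hrI c) (neg_pos.2 ha) (neg_pos.2 hb) (neg_lt_zero.2 hc)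
      (hzr a) (hz a) (hzr b) (hz b) e
    refine ⟨K, h₁, h₂, h₃, h₄, h₅.mono fun ε hε y hy => ?_⟩
    have := hε y hy
    rwa [monomialDiff_neg, neg_lt_zero] at this
  -- Quadrants 0 and 1 share a positive second exponent, 1 and 2 a negative first, 2 and 3 a
  -- negative second, 3 and 0 a positive first. The last index names a facet of opposite sign.
  obtain ⟨K₁, hc₁, ha₁, hb₁, hn₁, hε₁⟩ := arc 1 0 1 2 q₀.2 q₁.2 q₂.2
  obtain ⟨K₂, hc₂, ha₂, hb₂, hn₂, hε₂⟩ := arc' 0 1 2 0 q₁.1 q₂.1 q₀.1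
  obtain ⟨K₃, hc₃, ha₃, hb₃, hn₃, hε₃⟩ := arc' 1 2 3 0 q₂.2 q₃.2 q₀.2
  obtain ⟨K₄, hc₄, ha₄, hb₄, hn₄, hε₄⟩ := arc 0 3 0 1 q₃.1 q₀.1 q₁.1
  have hev : ∀ {p : ℝ → Prop}, (∀ᶠ ε in nhds 0, p ε) → ∀ᶠ ε in nhdsWithin 0 (Set.Ioi 0), p ε :=
    fun h => nhdsWithin_le_nhds h
  obtain ⟨ε, ⟨⟨⟨⟨hε₁, hε₂⟩, hε₃⟩, hε₄⟩, hε⟩⟩ :=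
    (((((hev hε₁).and (hev hε₂)).and (hev hε₃)).and (hev hε₄)).and self_mem_nhdsWithin).exists
  have hsub : ∀ K : Set (Fin 3 → ℝ), (∀ y ∈ K, ∀ i, 0 ≤ (D *ᵥ y) i) →
      (fun y => y + ε • e) '' K ⊆ dualCone D := by
    rintro K hK _ ⟨y, hy, rfl⟩ i
    rw [dotProduct_add, dotProduct_smul]
    exact add_pos_of_nonneg_of_pos (hK y hy i) (mul_pos hε (he i))
  have hcon : ∀ K : Set (Fin 3 → ℝ), IsPreconnected K →
      IsPreconnected ((fun y => y + ε • e) '' K) := fun K hK =>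
    hK.image _ (continuous_id.add continuous_const).continuousOn
  obtain ⟨y, hy, hy0, hy1⟩ := exists_zero_of_sign_circuit (convex_dualCone D) (isOpen_dualCone D)
    (continuous_monomialDiff D (β 0)).continuousOn (continuous_monomialDiff D (β 1)).continuousOn
    (hsub K₁ hn₁) (hsub K₂ hn₂) (hsub K₃ hn₃) (hsub K₄ hn₄)
    (hcon K₁ hc₁) (hcon K₂ hc₂) (hcon K₃ hc₃) (hcon K₄ hc₄)
    (Set.forall_mem_image.2 hε₁) (Set.forall_mem_image.2 hε₂) (Set.forall_mem_image.2 hε₃)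
    (Set.forall_mem_image.2 hε₄)
    ⟨_, Set.mem_image_of_mem _ hb₁, Set.mem_image_of_mem _ ha₂⟩
    ⟨_, Set.mem_image_of_mem _ hb₂, Set.mem_image_of_mem _ ha₃⟩
    ⟨_, Set.mem_image_of_mem _ hb₃, Set.mem_image_of_mem _ ha₄⟩
    ⟨_, Set.mem_image_of_mem _ hb₄, Set.mem_image_of_mem _ ha₁⟩
  exact ⟨y, hy, fun j => by fin_cases j <;> assumption⟩

end BoundaryArc

/-! ### Gale duality for positive solutions -/

/-- A vector orthogonal to the columns of a Gale dual of `M` lies in the row space of `M`. -/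
theorem IsGaleDual.exists_vecMul_eq {r s t : ℕ} {M : Matrix (Fin r) (Fin s) ℝ}
    {N : Matrix (Fin s) (Fin t) ℝ} (h : IsGaleDual M N) {v : Fin s → ℝ} (hv : v ᵥ* N = 0) :
    ∃ u, u ᵥ* M = v := by
  -- The functional given by `v` kills the kernel of `M`, hence factors through `M`; the coordinates
  -- of the factor are the row coefficients.
  have hmem : dotProductBilin ℝ ℝ v ∈ (LinearMap.ker M.mulVecLin).dualAnnihilator := by
    rw [Submodule.mem_dualAnnihilator]
    intro x hx
    obtain ⟨y, rfl⟩ := (h.mulVec_eq_zero_iff x).1 hx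
    change v ⬝ᵥ N *ᵥ y = 0
    rw [dotProduct_mulVec, hv, zero_dotProduct]
  rw [← LinearMap.range_dualMap_eq_dualAnnihilator_ker] at hmem
  obtain ⟨φ, hφ⟩ := hmem
  refine ⟨fun i => φ (Pi.single i 1), ?_⟩
  ext j
  have hj : φ (M *ᵥ Pi.single j 1) = v ⬝ᵥ Pi.single j 1 := LinearMap.congr_fun hφ (Pi.single j 1)
  rw [dotProduct_single_one] at hj
  rw [← hj, Matrix.mulVec_single_one, LinearMap.pi_apply_eq_sum_univ φ]
  simp only [vecMul, dotProduct, smul_eq_mul]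
  refine Finset.sum_congr rfl fun i _ => ?_
  have hsingle : (Pi.single i 1 : Fin r → ℝ) = fun j => if i = j then 1 else 0 := by
    ext j
    simp [Pi.single_apply, eq_comm]
  rw [mul_comm, hsingle]
  rfl

/-- A positive vector in the kernel of `C` whose logarithm is orthogonal to a Gale dual of the
configuration matrix comes from a positive solution of the system. -/
theorem positiveSolutions_nonempty_of_log {d n : ℕ} {a : Fin n → Fin d → ℤ}
    {C : Matrix (Fin d) (Fin n) ℝ} {t : ℕ} {N : Matrix (Fin n) (Fin t) ℝ}
    (hN : IsGaleDual (toReal (configMatrix a)) N) {v : Fin n → ℝ} (hv : ∀ i, 0 < v i)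
    (hCv : C *ᵥ v = 0) (hlog : (fun i => Real.log (v i)) ᵥ* N = 0) :
    (positiveSolutions a C).Nonempty := by
  obtain ⟨u, hu⟩ := hN.exists_vecMul_eq hlog
  -- The coefficient `u 0` of the row of ones contributes only a common positive factor, which
  -- cancels in the homogeneous equations; the other coefficients are the logarithms of the
  -- solution.
  have hprod : ∀ j, v j = Real.exp (u 0) * ∏ l, Real.exp (u (Fin.succ l)) ^ a j l := by
    intro j
    have hj : ∑ i, u i * ((configMatrix a i j : ℤ) : ℝ) = Real.log (v j) := congrFun hu j
    rw [Fin.sum_univ_succ] at hj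
    rw [← Real.exp_log (hv j), ← hj, Real.exp_add, Real.exp_sum]
    congr 1
    · simp [configMatrix]
    · refine Finset.prod_congr rfl fun l _ => ?_
      rw [← Real.rpow_intCast, ← Real.exp_mul]
      simp [configMatrix]
  refine ⟨fun l => Real.exp (u l.succ), fun l => Real.exp_pos _, fun i => ?_⟩
  have hi : ∑ j, C i j * v j = 0 := congrFun hCv i
  refine (mul_eq_zero.1 ?_).resolve_left (Real.exp_pos (u 0)).ne'
  rw [← hi, Finset.mul_sum]
  refine Finset.sum_congr rfl fun j _ => ?_
  rw [hprod j]
  ring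

end GaleDuality

theorem proposition6p3 {d : ℕ}
    -- the integer configuration, whose matrix is uniform of codimension 2
    (a : Fin (d + 3) → Fin d → ℤ) (hA : GaleDuality.IsUniform (GaleDuality.configMatrix a))
    (B : Matrix (Fin (d + 3)) (Fin 2) ℤ)
    (hB : GaleDuality.IsGaleDual (GaleDuality.toReal (GaleDuality.configMatrix a))
      (GaleDuality.toReal B))
    (hCM : ¬ GaleDuality.IsCohenMacaulayIdeal
      (GaleDuality.latticeIdeal (GaleDuality.columnLattice B)))
    -- another Gale dual, whose columns form a basis of the same lattice
    (B' : Matrix (Fin (d + 3)) (Fin 2) ℤ)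
    (hB' : GaleDuality.IsGaleDual (GaleDuality.toReal (GaleDuality.configMatrix a))
      (GaleDuality.toReal B'))
    (hbasis : LinearIndependent ℤ B'.col ∧
      Submodule.span ℤ (Set.range B'.col) = GaleDuality.columnLattice B)
    -- four rows of it, in four different open quadrants
    (i : Fin 4 → Fin (d + 3)) (q : Equiv.Perm (Fin 4))
    (hquad : ∀ j, B'.row (i j) ∈ GaleDuality.openQuadrant (q j))
    (C : Matrix (Fin d) (Fin (d + 3)) ℝ) (hC : GaleDuality.IsUniform C)
    (h0 : (0 : Fin d → ℝ) ∈ GaleDuality.positiveCone C.col)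
    -- a Gale dual matrix of `C`, with rows `P_1, …, P_n`
    (D : Matrix (Fin (d + 3)) (Fin 3) ℝ) (hD : GaleDuality.IsGaleDual C D)
    (hfacet : ∀ j, GaleDuality.IsFacetNormal (closure (GaleDuality.dualCone D)) (D.row (i j)))
    -- the index set of the minimal generators of the cone of the `P_i`
    (I : Set (Fin (d + 3))) (hI : GaleDuality.IsMinimalGenerators D I)
    (hsign : ∀ j : Fin 2,
      GaleDuality.signVector (I.domRestrict ((GaleDuality.toReal B').col j)) ∈
        (fun v : Fin (d + 3) → ℝ => GaleDuality.signVector (I.domRestrict v)) ''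
          (LinearMap.ker C.mulVecLin : Set (Fin (d + 3) → ℝ))) :
    0 < GaleDuality.numPositiveSolutions a C := by
  have hne := hD.dualCone_nonempty h0
  have hw : ∀ j : Fin 2, ∃ w : Fin 3 → ℝ, ∀ k ∈ I,
      SignType.sign ((D *ᵥ w) k) = SignType.sign (B' k j) := by
    intro j
    obtain ⟨v, hv, hvs⟩ := hsign j
    obtain ⟨w, rfl⟩ := (hD.mulVec_eq_zero_iff v).1 hv
    refine ⟨w, fun k hk => (congrFun hvs ⟨k, hk⟩).trans ?_⟩
    change SignType.sign ((B' k j : ℤ) : ℝ) = _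
    rcases lt_trichotomy (B' k j) 0 with h | h | h
    · rw [sign_neg h, sign_neg (by exact_mod_cast h)]
    · simp [h]
    · rw [sign_pos h, sign_pos (by exact_mod_cast h)]
  choose w hw using hw
  -- Reindexing by `q.symm` places the `k`-th facet in quadrant `k`, as the cyclic order of the
  -- circuit requires.
  obtain ⟨y, hy, hy0⟩ := GaleDuality.exists_mem_dualCone_monomialDiff_eq_zero hC hD hne hI
    B'.col hw (r := fun k => i (q.symm k))
    (fun k => by
      have := hquad (q.symm k)
      rwa [Equiv.apply_symm_apply] at this)
    (fun k => hfacet (q.symm k))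
  refine Set.encard_pos.2 (GaleDuality.positiveSolutions_nonempty_of_log hB' (v := D *ᵥ y) hy
    ((hD.mulVec_eq_zero_iff _).2 ⟨y, rfl⟩) ?_)
  ext j
  rw [Pi.zero_apply, ← GaleDuality.sum_mul_log_eq_zero (D := D) hy (hy0 j)]
  exact dotProduct_comm (fun k => Real.log ((D *ᵥ y) k)) fun k => (B' k j : ℝ)
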